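/- **Corollary A ($L^\infty$-smoothing).** Let $n\ge 1$. A (nontrivial) *Young's function* is a map $\Phi:[0,\infty]\to[0,\infty]$ with $\Phi(0)=0$ such that one of the following holds: (I) $\Phi$ is convex, increasing (i.e. non-decreasing), finite-valued and not identically zero on $[0,\infty)$ (and $\Phi(\infty)=\infty$); (II) for some $a\in(0,\infty)$, $\Phi$ is convex, increasing and finite-valued on $[0,a]$ and $\Phi=\infty$ on $(a,\infty]$; (III) for some $a\in(0,\infty)$, $\Phi$ is convex, increasing and finite-valued on $[0,a)$, $\lim_{x\uparrow a}\Phi(x)=\infty$, and $\Phi=\infty$ on $[a,\infty]$. $\Phi$ is called *finite* if (I) holds. Its generalised inverse is $\Phi^{-1}(y)=\inf\{x>0:\Phi(x)>y\}$, with $\inf\emptyset=\infty$. The Orlicz space $L^\Phi=L^\Phi(\mathbb{R}^n)$ consists of the (a.e.-classes of) Lebesgue measurable $u:\mathbb{R}^n\to\mathbb{R}$ with $\int_{\mathbb{R}^n}\Phi(|u(x)|/k)\,dx<\infty$ for some $k>0$, with the Luxemburg norm $\|u\|_\Phi=\inf\{k>0:\int_{\mathbb{R}^n}\Phi(|u(x)|/k)\,dx\le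 1\}$, and $L^\Phi_0$ is the closure of $C_0^\infty(\mathbb{R}^n)$ (smooth functions with compact support) in $L^\Phi$. For $t>0$ let $[S(t)\varphi](x)=\int_{\mathbb{R}^n}G(x-y,t)\varphi(y)\,dy$ with $G(x,t)=(4\pi t)^{-n/2}\exp(-|x|^2/(4t))$. Let $\Phi$ be a Young's function. (i) There exists a constant $C=C(n,\Phi)>0$ such that for all $\varphi\in L^\Phi$ and $t>0$ the integral defining $[S(t)\varphi](x)$ converges absolutely for every $x\in\mathbb{R}^n$, $S(t)\varphi\in L^\infty(\mathbb{R}^n)$, and $$\|S(t)\varphi\|_\infty\le C\,\Phi^{-1}(t^{-n/2})\,\|\varphi\|_\Phi .$$ (ii) If $\Phi$ is finite, then $$\lim_{t\to 0^+}\frac{\|S(t)\varphi\|_\infty}{\Phi^{-1}(t^{-n/2})}=0$$ uniformly for $\varphi$ in compact subsets of $L^\Phi_0$. -/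

import Mathlib

open MeasureTheory Filter Topology Set
open scoped ENNReal NNReal

/-! Young's functions -/

/-- Type (I): finite-valued on `[0, ∞)`. (Being monotone on `[0, ∞]`, convex and not identically
zero on `[0, ∞)`, such a function automatically takes the value `∞` at `∞`.) -/
def IsYoungTypeI (Φ : ℝ≥0∞ → ℝ≥0∞) : Prop :=
  Monotone Φ ∧ ConvexOn ℝ≥0 (Iio ⊤) Φ ∧ (∀ x < ⊤, Φ x < ⊤) ∧ ∃ x < ⊤, Φ x ≠ 0

/-- Type (II): finite-valued on `[0, a]` and infinite beyond `a`. -/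
def IsYoungTypeII (Φ : ℝ≥0∞ → ℝ≥0∞) : Prop :=
  ∃ a : ℝ≥0∞, 0 < a ∧ a < ⊤ ∧ ConvexOn ℝ≥0 (Iic a) Φ ∧ MonotoneOn Φ (Iic a) ∧
    (∀ x ≤ a, Φ x < ⊤) ∧ ∀ x, a < x → Φ x = ⊤

/-- Type (III): finite-valued on `[0, a)`, tending to `∞` at `a`, and infinite from `a` on. -/
def IsYoungTypeIII (Φ : ℝ≥0∞ → ℝ≥0∞) : Prop :=
  ∃ a : ℝ≥0∞, 0 < a ∧ a < ⊤ ∧ ConvexOn ℝ≥0 (Iio a) Φ ∧ MonotoneOn Φ (Iio a) ∧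
    (∀ x < a, Φ x < ⊤) ∧ Tendsto Φ (𝓝[<] a) (𝓝 ⊤) ∧ ∀ x, a ≤ x → Φ x = ⊤

/-- A (nontrivial) Young's function `Φ : [0, ∞] → [0, ∞]`, possibly taking the value `∞`. -/
structure YoungFunction where
  toFun : ℝ≥0∞ → ℝ≥0∞
  map_zero : toFun 0 = 0
  isYoung : IsYoungTypeI toFun ∨ IsYoungTypeII toFun ∨ IsYoungTypeIII toFun

namespace YoungFunction

instance : CoeFun YoungFunction (fun _ => ℝ≥0∞ → ℝ≥0∞) := ⟨toFun⟩

/-- A Young's function is finite if it is of type (I). -/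
def IsFinite (Φ : YoungFunction) : Prop := IsYoungTypeI Φ

/-- The generalised inverse `Φ⁻¹(y) = inf {x > 0 : Φ(x) > y}`, where `inf ∅ = ∞`. -/
noncomputable def inv (Φ : YoungFunction) (y : ℝ≥0∞) : ℝ≥0∞ :=
  sInf {x | 0 < x ∧ y < Φ x}

variable (Φ : YoungFunction)

theorem mono : Monotone Φ := by
  rcases Φ.isYoung with h | ⟨a, _, _, _, hm, _, ht⟩ | ⟨a, _, _, _, hm, _, _, ht⟩
  · exact h.1
  · intro x y hxy
    rcases le_or_gt y a with hy | hy
    · exact hm (hxy.trans hy) hy hxy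
    · rw [ht y hy]; exact le_top
  · intro x y hxy
    rcases lt_or_ge y a with hy | hy
    · exact hm (hxy.trans_lt hy) hy hxy
    · rw [ht y hy]; exact le_top

theorem convex {a b : ℝ≥0} (hab : a + b = 1) {x y : ℝ≥0∞} (hx : x < ⊤) (hy : y < ⊤) :
    Φ (a • x + b • y) ≤ a • Φ x + b • Φ y := by
  rcases eq_or_ne a 0 with rfl | ha
  · have : b = 1 := by simpa using hab
    simp [this]
  rcases eq_or_ne b 0 with rfl | hb
  · have : a = 1 := by simpa using hab
    simp [this]
  by_cases hx' : Φ x = ⊤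
  · rw [hx', show a • (⊤ : ℝ≥0∞) = ⊤ by
      rw [ENNReal.smul_def, smul_eq_mul, ENNReal.mul_top (by simpa using ha)], top_add]; exact le_top
  by_cases hy' : Φ y = ⊤
  · rw [hy', show b • (⊤ : ℝ≥0∞) = ⊤ by
      rw [ENNReal.smul_def, smul_eq_mul, ENNReal.mul_top (by simpa using hb)], add_top]; exact le_top
  rcases Φ.isYoung with h | ⟨c, _, _, hc, _, _, ht⟩ | ⟨c, _, _, hc, _, _, _, ht⟩
  · exact h.2.1.2 hx hy zero_le zero_le hab
  · refine hc.2 (?_ : x ≤ c) (?_ : y ≤ c) zero_le zero_le hab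
    · by_contra h; exact hx' (ht x (not_le.1 h))
    · by_contra h; exact hy' (ht y (not_le.1 h))
  · refine hc.2 (?_ : x < c) (?_ : y < c) zero_le zero_le hab
    · by_contra h; exact hx' (ht x (not_lt.1 h))
    · by_contra h; exact hy' (ht y (not_lt.1 h))

theorem exists_pos : ∃ x < ⊤, Φ x ≠ 0 := by
  rcases Φ.isYoung with h | ⟨a, _, ha, _, _, _, ht⟩ | ⟨a, _, ha, _, _, _, _, ht⟩
  · exact h.2.2.2
  · refine ⟨a + 1, by simpa using ha, ?_⟩
    rw [ht (a + 1) (ENNReal.lt_add_right ha.ne one_ne_zero)]; simp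
  · exact ⟨a, ha, by rw [ht a le_rfl]; simp⟩

theorem unbounded (m : ℝ≥0) : ∃ x : ℝ, 0 < x ∧ (m : ℝ≥0∞) ≤ Φ (ENNReal.ofReal x) := by
  obtain ⟨x, hx, hx0⟩ := Φ.exists_pos
  lift x to ℝ≥0 using hx.ne
  have hxpos : x ≠ 0 := by rintro rfl; exact hx0 (by simpa using Φ.map_zero)
  obtain ⟨N, hN⟩ : ∃ N : ℕ, (m : ℝ≥0∞) ≤ N * Φ x := by
    rcases eq_or_ne (Φ x) ⊤ with h | h
    · exact ⟨1, by simp [h]⟩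
    · obtain ⟨N, hN⟩ := ENNReal.exists_nat_mul_gt hx0 (b := (m : ℝ≥0∞)) (by simp)
      exact ⟨N, hN.le⟩
  have key := Φ.convex (a := (N + 1 : ℝ≥0)⁻¹) (b := 1 - (N + 1 : ℝ≥0)⁻¹)
    (x := (((N + 1 : ℝ≥0) * x : ℝ≥0) : ℝ≥0∞)) (y := 0)
    (add_tsub_cancel_of_le (inv_le_one_of_one_le₀ (by simp))) ENNReal.coe_lt_top (by simp)
  have hN1 : (N + 1 : ℝ≥0) ≠ 0 := by positivity
  rw [smul_zero, add_zero, Φ.map_zero, smul_zero, add_zero, ENNReal.smul_def, smul_eq_mul,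
    ← ENNReal.coe_mul, inv_mul_cancel_left₀ hN1, ENNReal.smul_def, smul_eq_mul] at key
  refine ⟨(N + 1 : ℝ≥0) * x, by positivity, ?_⟩
  have e : ENNReal.ofReal (((N + 1 : ℝ≥0) : ℝ) * (x : ℝ)) = (((N + 1 : ℝ≥0) * x : ℝ≥0) : ℝ≥0∞) := by
    rw [← NNReal.coe_mul, ENNReal.ofReal_coe_nnreal]
  rw [e]
  calc (m : ℝ≥0∞) ≤ N * Φ x := hN
    _ ≤ ((N + 1 : ℝ≥0) : ℝ≥0∞) * Φ x := by gcongr; push_cast; exact le_self_add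
    _ ≤ ((N + 1 : ℝ≥0) : ℝ≥0∞) * (((N + 1 : ℝ≥0)⁻¹ : ℝ≥0) *
          Φ (((N + 1 : ℝ≥0) * x : ℝ≥0) : ℝ≥0∞)) := by gcongr
    _ = Φ (((N + 1 : ℝ≥0) * x : ℝ≥0) : ℝ≥0∞) := by
        rw [← mul_assoc, ← ENNReal.coe_mul, mul_inv_cancel₀ hN1, ENNReal.coe_one, one_mul]

end YoungFunction

/-! Orlicz spaces on `ℝⁿ` -/

/-- `∫ Φ(|u(x)| / k) dx`. -/
noncomputable def orliczModular (Φ : YoungFunction) {n : ℕ} (u : EuclideanSpace ℝ (Fin n) → ℝ)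
    (k : ℝ) : ℝ≥0∞ :=
  ∫⁻ x, Φ (ENNReal.ofReal (|u x| / k))

/-- The Luxemburg norm `‖u‖_Φ = inf {k > 0 : ∫ Φ(|u(x)| / k) dx ≤ 1}`. -/
noncomputable def luxemburgNorm (Φ : YoungFunction) {n : ℕ}
    (u : EuclideanSpace ℝ (Fin n) → ℝ) : ℝ :=
  sInf {k : ℝ | 0 < k ∧ orliczModular Φ u k ≤ 1}

section OrliczAux

variable {Φ : YoungFunction} {n : ℕ}

theorem orliczModular_congr {u v : EuclideanSpace ℝ (Fin n) → ℝ} (h : u =ᵐ[volume] v) (k : ℝ) :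
    orliczModular Φ u k = orliczModular Φ v k :=
  lintegral_congr_ae (h.mono fun x hx => by simp only [hx])

theorem luxemburgNorm_congr {u v : EuclideanSpace ℝ (Fin n) → ℝ} (h : u =ᵐ[volume] v) :
    luxemburgNorm Φ u = luxemburgNorm Φ v := by
  simp only [luxemburgNorm, orliczModular_congr h]

theorem orliczModular_zero (k : ℝ) :
    orliczModular Φ (0 : EuclideanSpace ℝ (Fin n) → ℝ) k = 0 := by
  simp [orliczModular, Φ.map_zero]

theorem orliczModular_smul {c : ℝ} (hc : c ≠ 0) (u : EuclideanSpace ℝ (Fin n) → ℝ) (k : ℝ) :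
    orliczModular Φ (c • u) (|c| * k) = orliczModular Φ u k := by
  unfold orliczModular
  refine lintegral_congr fun x => ?_
  rw [Pi.smul_apply, smul_eq_mul, abs_mul, mul_div_mul_left _ _ (abs_ne_zero.2 hc)]

theorem orliczModular_add_le {u : EuclideanSpace ℝ (Fin n) → ℝ} (hu : AEMeasurable u)
    (v : EuclideanSpace ℝ (Fin n) → ℝ) {k l : ℝ} (hk : 0 < k) (hl : 0 < l) :
    orliczModular Φ (u + v) (k + l) ≤
      ENNReal.ofReal (k / (k + l)) * orliczModular Φ u k +
        ENNReal.ofReal (l / (k + l)) * orliczModular Φ v l := by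
  have hkl : 0 < k + l := by positivity
  have hmu : AEMeasurable (fun x => Φ (ENNReal.ofReal (|u x| / k))) :=
    Φ.mono.measurable.comp_aemeasurable
      (((continuous_abs.measurable.comp_aemeasurable hu).div_const k).ennreal_ofReal)
  unfold orliczModular
  rw [← lintegral_const_mul' _ _ ENNReal.ofReal_ne_top,
    ← lintegral_const_mul' _ _ ENNReal.ofReal_ne_top,
    ← lintegral_add_left' (hmu.const_mul _)]
  refine lintegral_mono fun x => ?_
  have hab : Real.toNNReal (k / (k + l)) + Real.toNNReal (l / (k + l)) = 1 := by
    rw [← Real.toNNReal_add (by positivity) (by positivity), ← add_div, div_self hkl.ne',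
      Real.toNNReal_one]
  have h := Φ.convex hab (x := ENNReal.ofReal (|u x| / k)) (y := ENNReal.ofReal (|v x| / l))
    ENNReal.ofReal_lt_top ENNReal.ofReal_lt_top
  rw [ENNReal.smul_def, ENNReal.smul_def, ENNReal.smul_def, ENNReal.smul_def] at h
  refine le_trans (Φ.mono ?_) h
  change _ ≤ ENNReal.ofReal (k / (k + l)) * ENNReal.ofReal (|u x| / k) +
    ENNReal.ofReal (l / (k + l)) * ENNReal.ofReal (|v x| / l)
  rw [← ENNReal.ofReal_mul (by positivity), ← ENNReal.ofReal_mul (by positivity),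
    ← ENNReal.ofReal_add (by positivity) (by positivity)]
  refine ENNReal.ofReal_le_ofReal ?_
  have e : k / (k + l) * (|u x| / k) + l / (k + l) * (|v x| / l) = (|u x| + |v x|) / (k + l) := by
    field_simp
  rw [e, Pi.add_apply]
  gcongr
  exact abs_add_le _ _

theorem exists_orliczModular_le_one {u : EuclideanSpace ℝ (Fin n) → ℝ} (hu : AEMeasurable u)
    (h : ∃ k : ℝ, 0 < k ∧ orliczModular Φ u k < ⊤) :
    ∃ k : ℝ, 0 < k ∧ orliczModular Φ u k ≤ 1 := by
  obtain ⟨k, hk, hfin⟩ := h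
  set m : ℝ := (orliczModular Φ u k).toReal with hm
  have hm0 : 0 ≤ m := ENNReal.toReal_nonneg
  have hl : 0 < k * (m + 1) := by positivity
  refine ⟨k + k * (m + 1), by positivity, ?_⟩
  have key := orliczModular_add_le (Φ := Φ) hu 0 hk hl
  rw [add_zero, orliczModular_zero, mul_zero, add_zero] at key
  refine key.trans ?_
  rw [← ENNReal.ofReal_toReal hfin.ne, ← hm, ← ENNReal.ofReal_mul (by positivity),
    ← ENNReal.ofReal_one]
  refine ENNReal.ofReal_le_ofReal ?_
  rw [div_mul_eq_mul_div, div_le_one (by positivity)]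
  nlinarith

theorem luxemburgNorm_bddBelow (u : EuclideanSpace ℝ (Fin n) → ℝ) :
    BddBelow {k : ℝ | 0 < k ∧ orliczModular Φ u k ≤ 1} :=
  ⟨0, fun _ hk => hk.1.le⟩

theorem luxemburgNorm_nonneg (u : EuclideanSpace ℝ (Fin n) → ℝ) : 0 ≤ luxemburgNorm Φ u :=
  Real.sInf_nonneg fun _ hk => hk.1.le

theorem luxemburgNorm_zero :
    luxemburgNorm Φ (0 : EuclideanSpace ℝ (Fin n) → ℝ) = 0 := by
  have : {k : ℝ | 0 < k ∧ orliczModular Φ (0 : EuclideanSpace ℝ (Fin n) → ℝ) k ≤ 1} = Ioi 0 := by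
    ext k; simp [orliczModular_zero]
  rw [luxemburgNorm, this, csInf_Ioi]

theorem luxemburgNorm_add_le {u v : EuclideanSpace ℝ (Fin n) → ℝ} (hu : AEMeasurable u)
    (hu' : ∃ k : ℝ, 0 < k ∧ orliczModular Φ u k ≤ 1)
    (hv' : ∃ k : ℝ, 0 < k ∧ orliczModular Φ v k ≤ 1) :
    luxemburgNorm Φ (u + v) ≤ luxemburgNorm Φ u + luxemburgNorm Φ v := by
  have h : ∀ k l : ℝ, 0 < k ∧ orliczModular Φ u k ≤ 1 → 0 < l ∧ orliczModular Φ v l ≤ 1 →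
      luxemburgNorm Φ (u + v) ≤ k + l := by
    rintro k l ⟨hk, hku⟩ ⟨hl, hlv⟩
    refine csInf_le (luxemburgNorm_bddBelow _) ⟨by positivity, ?_⟩
    refine (orliczModular_add_le hu v hk hl).trans ?_
    calc _ ≤ ENNReal.ofReal (k / (k + l)) * 1 + ENNReal.ofReal (l / (k + l)) * 1 := by gcongr
      _ = 1 := by
        rw [mul_one, mul_one, ← ENNReal.ofReal_add (by positivity) (by positivity), ← add_div,
          div_self (by positivity), ENNReal.ofReal_one]
  have h1 : ∀ l : ℝ, 0 < l ∧ orliczModular Φ v l ≤ 1 →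
      luxemburgNorm Φ (u + v) - l ≤ luxemburgNorm Φ u := fun l hl =>
    le_csInf hu' fun k hk => by linarith [h k l hk hl]
  have h2 : luxemburgNorm Φ (u + v) - luxemburgNorm Φ u ≤ luxemburgNorm Φ v :=
    le_csInf hv' fun l hl => by linarith [h1 l hl]
  linarith

theorem luxemburgNorm_smul_le (c : ℝ) (u : EuclideanSpace ℝ (Fin n) → ℝ)
    (hu' : ∃ k : ℝ, 0 < k ∧ orliczModular Φ u k ≤ 1) :
    luxemburgNorm Φ (c • u) ≤ |c| * luxemburgNorm Φ u := by
  rcases eq_or_ne c 0 with rfl | hc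
  · simp [luxemburgNorm_zero]
  have hc' : 0 < |c| := abs_pos.2 hc
  rw [mul_comm, ← div_le_iff₀ hc']
  refine le_csInf hu' fun k hk => ?_
  rw [div_le_iff₀ hc']
  refine csInf_le (luxemburgNorm_bddBelow _) ⟨mul_pos hk.1 hc', ?_⟩
  rw [mul_comm, orliczModular_smul hc]
  exact hk.2

theorem ae_eq_zero_of_luxemburgNorm_eq_zero {u : EuclideanSpace ℝ (Fin n) → ℝ}
    (hu' : ∃ k : ℝ, 0 < k ∧ orliczModular Φ u k ≤ 1) (h : luxemburgNorm Φ u = 0)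
    (hu : AEMeasurable u) : u =ᵐ[volume] 0 := by
  have key : ∀ j : ℕ, volume {x | (1 / ((j : ℝ) + 1)) ≤ |u x|} = 0 := by
    intro j
    have hle : ∀ m : ℝ≥0, (m : ℝ≥0∞) * volume {x | (1 / ((j : ℝ) + 1)) ≤ |u x|} ≤ 1 := by
      intro m
      obtain ⟨x0, hx0, hm⟩ := Φ.unbounded m
      have hpos : 0 < (1 / ((j : ℝ) + 1)) / x0 := by positivity
      obtain ⟨k, ⟨hk, hk1⟩, hlt⟩ := exists_lt_of_csInf_lt hu'
        (show sInf {k : ℝ | 0 < k ∧ orliczModular Φ u k ≤ 1} < _ by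
          change luxemburgNorm Φ u < _; rw [h]; exact hpos)
      have hmu : AEMeasurable (fun x => Φ (ENNReal.ofReal (|u x| / k))) :=
        Φ.mono.measurable.comp_aemeasurable
          (((continuous_abs.measurable.comp_aemeasurable hu).div_const k).ennreal_ofReal)
      refine le_trans ?_ ((mul_meas_ge_le_lintegral₀ hmu (m : ℝ≥0∞)).trans hk1)
      gcongr
      intro hx
      refine hm.trans (Φ.mono (ENNReal.ofReal_le_ofReal ?_))
      rw [lt_div_iff₀ hx0] at hlt
      rw [le_div_iff₀ hk]
      linarith
    by_contra hne
    obtain ⟨N, hN⟩ := ENNReal.exists_nat_mul_gt hne (b := 1) (by simp)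
    exact absurd (hle (N : ℝ≥0)) (not_le.2 (by simpa using hN))
  have h0 : ∀ᵐ x, ∀ j : ℕ, ¬ (1 / ((j : ℝ) + 1)) ≤ |u x| := by
    rw [ae_all_iff]
    intro j
    rw [ae_iff]
    simpa using key j
  filter_upwards [h0] with x hx
  by_contra hne
  obtain ⟨j, hj⟩ := exists_nat_one_div_lt (abs_pos.2 hne)
  exact hx j hj.le

end OrliczAux

/-- The Orlicz space `L^Φ(ℝⁿ)`: (classes of) Lebesgue measurable real functions `u` on `ℝⁿ` such
that `∫ Φ(|u(x)| / k) dx < ∞` for some `k > 0`. -/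
noncomputable def OrliczSpace (Φ : YoungFunction) (n : ℕ) :
    Submodule ℝ (EuclideanSpace ℝ (Fin n) →ₘ[volume] ℝ) where
  carrier := {u | ∃ k : ℝ, 0 < k ∧ orliczModular Φ u k < ⊤}
  zero_mem' := ⟨1, one_pos, by
    rw [orliczModular_congr AEEqFun.coeFn_zero, orliczModular_zero]; simp⟩
  add_mem' := by
    rintro u v ⟨k, hk, hu⟩ ⟨l, hl, hv⟩
    refine ⟨k + l, by positivity, ?_⟩
    rw [orliczModular_congr (AEEqFun.coeFn_add u v)]
    refine (orliczModular_add_le u.aemeasurable v hk hl).trans_lt ?_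
    exact ENNReal.add_lt_top.2 ⟨ENNReal.mul_lt_top ENNReal.ofReal_lt_top hu,
      ENNReal.mul_lt_top ENNReal.ofReal_lt_top hv⟩
  smul_mem' := by
    rintro c u ⟨k, hk, hu⟩
    rcases eq_or_ne c 0 with rfl | hc
    · refine ⟨1, one_pos, ?_⟩
      rw [zero_smul, orliczModular_congr AEEqFun.coeFn_zero, orliczModular_zero]; simp
    · refine ⟨|c| * k, mul_pos (abs_pos.2 hc) hk, ?_⟩
      rw [orliczModular_congr (AEEqFun.coeFn_smul c u), orliczModular_smul hc]
      exact hu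

namespace OrliczSpace

variable {Φ : YoungFunction} {n : ℕ}

/-- `L^Φ(ℝⁿ)` carries the Luxemburg norm. -/
noncomputable instance : Norm (OrliczSpace Φ n) where
  norm u := luxemburgNorm Φ (u : EuclideanSpace ℝ (Fin n) →ₘ[volume] ℝ)

theorem norm_def (u : OrliczSpace Φ n) :
    ‖u‖ = luxemburgNorm Φ (u : EuclideanSpace ℝ (Fin n) →ₘ[volume] ℝ) := rfl

theorem exists_le_one (u : OrliczSpace Φ n) :
    ∃ k : ℝ, 0 < k ∧
      orliczModular Φ (u : EuclideanSpace ℝ (Fin n) →ₘ[volume] ℝ) k ≤ 1 :=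
  exists_orliczModular_le_one u.1.aemeasurable u.2

theorem norm_smul_le' (c : ℝ) (u : OrliczSpace Φ n) : ‖c • u‖ ≤ ‖c‖ * ‖u‖ := by
  rw [norm_def, norm_def, Submodule.coe_smul, luxemburgNorm_congr (AEEqFun.coeFn_smul c u.1),
    Real.norm_eq_abs]
  exact luxemburgNorm_smul_le c _ (exists_le_one u)

theorem normCore : NormedSpace.Core ℝ (OrliczSpace Φ n) where
  norm_nonneg u := luxemburgNorm_nonneg _
  norm_smul c u := by
    refine le_antisymm (norm_smul_le' c u) ?_
    rcases eq_or_ne c 0 with rfl | hc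
    · rw [norm_zero, zero_mul]; exact luxemburgNorm_nonneg _
    · have h := norm_smul_le' c⁻¹ (c • u)
      rw [inv_smul_smul₀ hc, norm_inv] at h
      rwa [← le_inv_mul_iff₀ (norm_pos_iff.2 hc)]
  norm_triangle u v := by
    rw [norm_def, norm_def, norm_def, Submodule.coe_add,
      luxemburgNorm_congr (AEEqFun.coeFn_add u.1 v.1)]
    exact luxemburgNorm_add_le u.1.aemeasurable (exists_le_one u) (exists_le_one v)
  norm_eq_zero_iff u := by
    constructor
    · intro h
      have := ae_eq_zero_of_luxemburgNorm_eq_zero (exists_le_one u) h u.1.aemeasurable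
      exact Subtype.ext (AEEqFun.ext (this.trans AEEqFun.coeFn_zero.symm))
    · rintro rfl
      rw [norm_def, Submodule.coe_zero, luxemburgNorm_congr AEEqFun.coeFn_zero,
        luxemburgNorm_zero]

noncomputable instance : NormedAddCommGroup (OrliczSpace Φ n) :=
  NormedAddCommGroup.ofCore normCore

noncomputable instance : NormedSpace ℝ (OrliczSpace Φ n) :=
  NormedSpace.ofCore normCore

end OrliczSpace

/-- `L_0^Φ(ℝⁿ)`: the closure of `C_0^∞(ℝⁿ)` (smooth functions with compact support) in
`L^Φ(ℝⁿ)` with respect to the Luxemburg norm. -/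
def OrliczSpaceZero (Φ : YoungFunction) (n : ℕ) : Set (OrliczSpace Φ n) :=
  closure {u | ∃ g : EuclideanSpace ℝ (Fin n) → ℝ, ContDiff ℝ ((⊤ : ℕ∞) : WithTop ℕ∞) g ∧ HasCompactSupport g ∧
    (u : EuclideanSpace ℝ (Fin n) →ₘ[volume] ℝ) =ᵐ[volume] g}

/-! The heat semigroup -/

/-- The Gaussian heat kernel `G(x, t) = (4πt)^(-n/2) exp(-|x|² / (4t))`. -/
noncomputable def heatKernel {n : ℕ} (x : EuclideanSpace ℝ (Fin n)) (t : ℝ) : ℝ :=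
  (4 * Real.pi * t) ^ (-(n : ℝ) / 2) * Real.exp (-‖x‖ ^ 2 / (4 * t))

/-- `[S(t)φ](x) = ∫ G(x - y, t) φ(y) dy`. -/
noncomputable def heatSemigroup {n : ℕ} (t : ℝ) (φ : EuclideanSpace ℝ (Fin n) → ℝ) :
    EuclideanSpace ℝ (Fin n) → ℝ :=
  fun x => ∫ y, heatKernel (x - y) t * φ y

/-! ### Growth of a Young's function and its generalised inverse -/

namespace YoungFunction

variable (Φ : YoungFunction)

/-! Put `Y = t^(-n/2)` and take `s > Φ⁻¹(Y)`, so `Φ(s) > Y`. By convexity and `Φ(0) = 0`, `Φ(w) / w`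
is nondecreasing, hence `w ≤ s + (s / Y) Φ(w)` for all finite `w` (`mul_le_of_inv_lt`). Apply this
to `w = |u| / k` and integrate against the heat kernel: its mass is 1, which handles the constant
term, and it is at most `Y`, which turns the other term into `s` times the modular. So the integral
of `G |u|` is at most `2 s k` once the modular at `k` is at most 1. Letting `s` and `k` decrease to
their infima gives (i) with `C = 2`.

For (ii), write `φ = (φ - g) + g` with `g` a test function. The bound from (i) controls the first
piece and `‖g‖_∞` the second; after division by `Φ⁻¹(Y)` the second vanishes as `t → 0`, because
`Φ⁻¹(Y) → ∞` for finite `Φ`. One `g` serves a whole ball, and compactness gives uniformity. -/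

theorem lt_apply_of_inv_lt {y s : ℝ≥0∞} (h : Φ.inv y < s) : y < Φ s := by
  obtain ⟨x, hx, hxs⟩ := sInf_lt_iff.1 h
  exact hx.2.trans_le (Φ.mono hxs.le)

theorem le_inv_of_apply_le {y s : ℝ≥0∞} (h : Φ s ≤ y) : s ≤ Φ.inv y :=
  le_of_not_gt fun hs => (Φ.lt_apply_of_inv_lt hs).not_ge h

theorem inv_ne_top {y : ℝ≥0∞} (hy : y ≠ ⊤) : Φ.inv y ≠ ⊤ := by
  -- The `+ 1` upgrades the weak inequality from `unbounded` to the strict one in the definition of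
  -- `inv`.
  obtain ⟨x, hx, hm⟩ := Φ.unbounded (y.toNNReal + 1)
  suffices y < Φ (ENNReal.ofReal x) from
    ne_top_of_le_ne_top ENNReal.ofReal_ne_top (sInf_le ⟨ENNReal.ofReal_pos.2 hx, this⟩)
  refine lt_of_lt_of_le ?_ hm
  rw [ENNReal.coe_add, ENNReal.coe_toNNReal hy]
  exact ENNReal.lt_add_right hy (by simp)

theorem apply_smul_le {a : ℝ≥0} (ha : a ≤ 1) {x : ℝ≥0∞} (hx : x < ⊤) :
    Φ (a • x) ≤ a • Φ x := by
  simpa [Φ.map_zero] using Φ.convex (add_tsub_cancel_of_le ha) hx ENNReal.zero_lt_top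

/-- Beyond the generalised inverse at `y`, the function grows at least linearly. -/
theorem mul_le_of_inv_lt {y : ℝ≥0∞} {s : ℝ≥0} (h : Φ.inv y < s) (w : ℝ≥0) :
    y * w ≤ y * s + s * Φ w := by
  rcases le_or_gt w s with hw | hw
  · exact le_add_right (by gcongr)
  refine le_add_left ?_
  have hw0 : w ≠ 0 := (pos_of_gt hw).ne'
  -- Since `s = (s / w) w` with `s / w ≤ 1`, convexity gives `Φ(s) ≤ (s / w) Φ(w)`.
  have key := Φ.apply_smul_le (a := s / w) (div_le_one_of_le₀ hw.le zero_le)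
    (ENNReal.coe_lt_top (r := w))
  rw [ENNReal.smul_def, ENNReal.smul_def, smul_eq_mul, smul_eq_mul, ← ENNReal.coe_mul,
    div_mul_cancel₀ _ hw0] at key
  calc y * w ≤ ((s / w : ℝ≥0) * Φ w) * w := by
        gcongr; exact (Φ.lt_apply_of_inv_lt h).le.trans key
    _ = ((s / w * w : ℝ≥0) : ℝ≥0∞) * Φ w := by rw [ENNReal.coe_mul]; ring
    _ = s * Φ w := by rw [div_mul_cancel₀ _ hw0]

variable {Φ} in
-- Once `y` exceeds the finite number `Φ(N + 1)`, the inverse is at least `N + 1`. For types (II)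
-- and (III) it stays at most `a` at finite `y`.
theorem IsFinite.tendsto_inv (h : Φ.IsFinite) : Tendsto Φ.inv (𝓝 ⊤) (𝓝 ⊤) := by
  rw [ENNReal.tendsto_nhds_top_iff_nnreal]
  intro N
  filter_upwards [lt_mem_nhds (h.2.2.1 ((N + 1 : ℝ≥0) : ℝ≥0∞) ENNReal.coe_lt_top)] with y hy
  exact (ENNReal.coe_lt_coe.2 (lt_add_one N)).trans_le (Φ.le_inv_of_apply_le hy.le)

end YoungFunction

/-! ### Gaussian kernel: height, mass and smoothing estimates -/

section HeatKernel

variable {n : ℕ} {t : ℝ}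

theorem heatKernel_nonneg (ht : 0 < t) (x : EuclideanSpace ℝ (Fin n)) : 0 ≤ heatKernel x t := by
  unfold heatKernel; positivity

theorem continuous_heatKernel (t : ℝ) :
    Continuous fun x : EuclideanSpace ℝ (Fin n) => heatKernel x t := by
  unfold heatKernel; fun_prop

theorem heatKernel_le (ht : 0 < t) (x : EuclideanSpace ℝ (Fin n)) :
    heatKernel x t ≤ t ^ (-(n : ℝ) / 2) := by
  have h1 : (4 * Real.pi * t) ^ (-(n : ℝ) / 2) ≤ t ^ (-(n : ℝ) / 2) := by
    refine Real.rpow_le_rpow_of_nonpos ht ?_ ?_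
    · nlinarith [Real.pi_gt_three]
    · have : (0 : ℝ) ≤ n := n.cast_nonneg
      linarith
  have h2 : Real.exp (-‖x‖ ^ 2 / (4 * t)) ≤ 1 := by
    rw [Real.exp_le_one_iff, neg_div]
    exact neg_nonpos.2 (by positivity)
  unfold heatKernel
  calc _ ≤ t ^ (-(n : ℝ) / 2) * 1 := by gcongr
    _ = _ := mul_one _

theorem integral_heatKernel (ht : 0 < t) :
    ∫ x : EuclideanSpace ℝ (Fin n), heatKernel x t = 1 := by
  have h := GaussianFourier.integral_rexp_neg_mul_sq_norm (V := EuclideanSpace ℝ (Fin n))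
    (b := 1 / (4 * t)) (by positivity)
  have e : ∀ x : EuclideanSpace ℝ (Fin n),
      Real.exp (-‖x‖ ^ 2 / (4 * t)) = Real.exp (-(1 / (4 * t)) * ‖x‖ ^ 2) := fun x => by
    congr 1; ring
  simp only [heatKernel, integral_const_mul, e, h]
  rw [finrank_euclideanSpace_fin, show Real.pi / (1 / (4 * t)) = 4 * Real.pi * t by field_simp,
    ← Real.rpow_add (by positivity), show -(n : ℝ) / 2 + n / 2 = 0 by ring, Real.rpow_zero]

theorem lintegral_heatKernel (ht : 0 < t) (x : EuclideanSpace ℝ (Fin n)) :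
    ∫⁻ y, ‖heatKernel (x - y) t‖ₑ = 1 := by
  -- The Bochner integral of a non-integrable function is 0 by convention, so the value 1 already
  -- forces integrability.
  have hint : Integrable fun x : EuclideanSpace ℝ (Fin n) => heatKernel x t :=
    Integrable.of_integral_ne_zero (by rw [integral_heatKernel ht]; exact one_ne_zero)
  rw [lintegral_sub_left_eq_self (fun y => ‖heatKernel y t‖ₑ) x,
    lintegral_congr fun y => Real.enorm_of_nonneg (heatKernel_nonneg ht y),
    ← ofReal_integral_eq_lintegral_ofReal hint (ae_of_all _ (heatKernel_nonneg ht)),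
    integral_heatKernel ht, ENNReal.ofReal_one]

theorem measurable_enorm_heatKernel_sub (t : ℝ) (x : EuclideanSpace ℝ (Fin n)) :
    Measurable fun y => ‖heatKernel (x - y) t‖ₑ :=
  ((continuous_heatKernel t).comp (continuous_const.sub continuous_id)).measurable.enorm

theorem lintegral_heatKernel_mul_le_of_bound (ht : 0 < t) {u : EuclideanSpace ℝ (Fin n) → ℝ}
    {B : ℝ≥0∞} (hB : ∀ᵐ y, ‖u y‖ₑ ≤ B) (x : EuclideanSpace ℝ (Fin n)) :
    ∫⁻ y, ‖heatKernel (x - y) t * u y‖ₑ ≤ B := by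
  calc _ ≤ ∫⁻ y, ‖heatKernel (x - y) t‖ₑ * B := by
        refine lintegral_mono_ae (hB.mono fun y hy => ?_)
        rw [enorm_mul]; gcongr
    _ = B := by
      rw [lintegral_mul_const _ (measurable_enorm_heatKernel_sub t x), lintegral_heatKernel ht,
        one_mul]

theorem lintegral_heatKernel_mul_le_of_modular {Φ : YoungFunction} (ht : 0 < t)
    {u : EuclideanSpace ℝ (Fin n) → ℝ} {k : ℝ} (hk : 0 < k) (hu : orliczModular Φ u k ≤ 1)
    {s : ℝ≥0} (hs : Φ.inv (ENNReal.ofReal (t ^ (-(n : ℝ) / 2))) < s)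
    (x : EuclideanSpace ℝ (Fin n)) :
    ∫⁻ y, ‖heatKernel (x - y) t * u y‖ₑ ≤ 2 * s * ENNReal.ofReal k := by
  set Y : ℝ≥0∞ := ENNReal.ofReal (t ^ (-(n : ℝ) / 2))
  have hY0 : Y ≠ 0 := (ENNReal.ofReal_pos.2 (by positivity)).ne'
  have hG : ∀ y, ‖heatKernel (x - y) t‖ₑ ≤ Y := fun y => by
    rw [Real.enorm_of_nonneg (heatKernel_nonneg ht _)]
    exact ENNReal.ofReal_le_ofReal (heatKernel_le ht _)
  -- The growth inequality is kept multiplied by `Y` to avoid division. The kernel stays on the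
  -- constant term, to be integrated to 1, and is replaced by `Y` on the `Φ` term.
  have hpt : ∀ y, Y * ‖heatKernel (x - y) t * u y‖ₑ ≤ ENNReal.ofReal k *
      (‖heatKernel (x - y) t‖ₑ * (Y * s) + s * Y * Φ (ENNReal.ofReal (|u y| / k))) := by
    intro y
    have hw : ‖u y‖ₑ = ENNReal.ofReal k * ENNReal.ofReal (|u y| / k) := by
      rw [← ENNReal.ofReal_mul hk.le, mul_div_cancel₀ _ hk.ne', Real.enorm_eq_ofReal_abs]
    calc _ = ENNReal.ofReal k * (‖heatKernel (x - y) t‖ₑ *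
          (Y * ENNReal.ofReal (|u y| / k))) := by rw [enorm_mul, hw]; ring
      _ ≤ ENNReal.ofReal k * (‖heatKernel (x - y) t‖ₑ *
          (Y * s + s * Φ (ENNReal.ofReal (|u y| / k)))) := by
        gcongr; exact Φ.mul_le_of_inv_lt hs _
      _ = ENNReal.ofReal k * (‖heatKernel (x - y) t‖ₑ * (Y * s) +
          s * ‖heatKernel (x - y) t‖ₑ * Φ (ENNReal.ofReal (|u y| / k))) := by ring
      _ ≤ _ := by gcongr; exact hG y
  have hmeas := measurable_enorm_heatKernel_sub t x
  have key : Y * ∫⁻ y, ‖heatKernel (x - y) t * u y‖ₑ ≤ Y * (2 * s * ENNReal.ofReal k) := by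
    rw [← lintegral_const_mul' _ _ ENNReal.ofReal_ne_top]
    refine (lintegral_mono hpt).trans ?_
    rw [lintegral_const_mul' _ _ ENNReal.ofReal_ne_top, lintegral_add_left (hmeas.mul_const _),
      lintegral_mul_const _ hmeas, lintegral_heatKernel ht,
      lintegral_const_mul' _ _ (ENNReal.mul_ne_top ENNReal.coe_ne_top ENNReal.ofReal_ne_top)]
    change ENNReal.ofReal k * (1 * (Y * s) + s * Y * orliczModular Φ u k) ≤ _
    calc _ ≤ ENNReal.ofReal k * (1 * (Y * s) + s * Y * 1) := by gcongr
      _ = _ := by ring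
  exact (ENNReal.mul_le_mul_iff_right hY0 ENNReal.ofReal_ne_top).1 key

theorem lintegral_heatKernel_mul_le {Φ : YoungFunction} (ht : 0 < t) (φ : OrliczSpace Φ n)
    (x : EuclideanSpace ℝ (Fin n)) :
    ∫⁻ y, ‖heatKernel (x - y) t * φ.1 y‖ₑ ≤
      2 * Φ.inv (ENNReal.ofReal (t ^ (-(n : ℝ) / 2))) * ENNReal.ofReal ‖φ‖ := by
  have hM := Φ.inv_ne_top (y := ENNReal.ofReal (t ^ (-(n : ℝ) / 2))) ENNReal.ofReal_ne_top
  generalize hMdef : Φ.inv (ENNReal.ofReal (t ^ (-(n : ℝ) / 2))) = M at hM ⊢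
  lift M to ℝ≥0 using hM
  -- The modular estimate needs `s` strictly above `M` and an admissible `k`, so both infima are
  -- enlarged by the same `δ`, which then tends to 0.
  have hlim : Tendsto (fun δ : ℝ≥0 => 2 * ((M + δ : ℝ≥0) : ℝ≥0∞) * ENNReal.ofReal (‖φ‖ + δ))
      (𝓝[>] 0) (𝓝 (2 * M * ENNReal.ofReal ‖φ‖)) := by
    have hc : Continuous fun δ : ℝ≥0 => ENNReal.ofReal (2 * (M + δ) * (‖φ‖ + δ)) :=
      ENNReal.continuous_ofReal.comp (by fun_prop)
    have e : ∀ δ : ℝ≥0, ENNReal.ofReal (2 * (M + δ) * (‖φ‖ + δ)) =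
        2 * ((M + δ : ℝ≥0) : ℝ≥0∞) * ENNReal.ofReal (‖φ‖ + δ) := fun δ => by
      rw [ENNReal.ofReal_mul (by positivity), ENNReal.ofReal_mul (by norm_num),
        ← NNReal.coe_add, ENNReal.ofReal_coe_nnreal, ENNReal.ofReal_ofNat]
    simp only [e] at hc
    simpa using (hc.tendsto 0).mono_left nhdsWithin_le_nhds
  refine ge_of_tendsto hlim ?_
  filter_upwards [self_mem_nhdsWithin] with δ hδ
  obtain ⟨k, ⟨hk, hk1⟩, hlt⟩ := exists_lt_of_csInf_lt (OrliczSpace.exists_le_one φ)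
    (show luxemburgNorm Φ φ.1 < ‖φ‖ + δ from lt_add_of_pos_right _ (NNReal.coe_pos.2 hδ))
  refine (lintegral_heatKernel_mul_le_of_modular ht hk hk1 (s := M + δ) ?_ x).trans ?_
  · rw [hMdef, ENNReal.coe_lt_coe]
    exact lt_add_of_pos_right _ hδ
  · gcongr

theorem stronglyMeasurable_heatSemigroup {u : EuclideanSpace ℝ (Fin n) → ℝ} (hu : Measurable u) :
    StronglyMeasurable (heatSemigroup t u) := by
  unfold heatSemigroup
  refine StronglyMeasurable.integral_prod_right
    (f := fun x y : EuclideanSpace ℝ (Fin n) => heatKernel (x - y) t * u y) ?_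
  refine Measurable.stronglyMeasurable (Measurable.mul ?_ (hu.comp measurable_snd))
  exact ((continuous_heatKernel t).comp (continuous_fst.sub continuous_snd)).measurable

theorem integrable_heatKernel_mul {Φ : YoungFunction} (ht : 0 < t) (φ : OrliczSpace Φ n)
    (x : EuclideanSpace ℝ (Fin n)) : Integrable fun y => heatKernel (x - y) t * φ.1 y := by
  refine ⟨(((continuous_heatKernel t).comp
    (continuous_const.sub continuous_id)).measurable.mul φ.1.measurable).aestronglyMeasurable, ?_⟩
  refine (lintegral_heatKernel_mul_le ht φ x).trans_lt ?_
  exact ENNReal.mul_lt_top (ENNReal.mul_lt_top (by simp)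
    (Φ.inv_ne_top ENNReal.ofReal_ne_top).lt_top) ENNReal.ofReal_lt_top

theorem eLpNorm_heatSemigroup_le_of_forall {u : EuclideanSpace ℝ (Fin n) → ℝ} {B : ℝ≥0∞}
    (h : ∀ x, ∫⁻ y, ‖heatKernel (x - y) t * u y‖ₑ ≤ B) :
    eLpNorm (heatSemigroup t u) ⊤ volume ≤ B := by
  rw [eLpNorm_exponent_top]
  exact essSup_le_of_ae_le _ (ae_of_all _ fun x => (enorm_integral_le_lintegral_enorm _).trans (h x))

theorem eLpNorm_heatSemigroup_le {Φ : YoungFunction} (ht : 0 < t) (φ : OrliczSpace Φ n) :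
    eLpNorm (heatSemigroup t φ.1) ⊤ volume ≤
      2 * Φ.inv (ENNReal.ofReal (t ^ (-(n : ℝ) / 2))) * ENNReal.ofReal ‖φ‖ :=
  eLpNorm_heatSemigroup_le_of_forall (lintegral_heatKernel_mul_le ht φ)

theorem eLpNorm_heatSemigroup_le_add {Φ : YoungFunction} (ht : 0 < t) (φ g : OrliczSpace Φ n)
    {B : ℝ≥0∞} (hB : ∀ᵐ y, ‖g.1 y‖ₑ ≤ B) :
    eLpNorm (heatSemigroup t φ.1) ⊤ volume ≤
      2 * Φ.inv (ENNReal.ofReal (t ^ (-(n : ℝ) / 2))) * ENNReal.ofReal ‖φ - g‖ + B := by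
  refine eLpNorm_heatSemigroup_le_of_forall fun x => ?_
  refine le_trans ?_ (add_le_add (lintegral_heatKernel_mul_le ht (φ - g) x)
    (lintegral_heatKernel_mul_le_of_bound ht hB x))
  rw [← lintegral_add_left' (integrable_heatKernel_mul ht (φ - g) x).aestronglyMeasurable.enorm]
  refine lintegral_mono_ae ?_
  filter_upwards [AEEqFun.coeFn_sub φ.1 g.1] with y hy
  refine le_trans (le_of_eq ?_) (enorm_add_le _ _)
  rw [Submodule.coe_sub, hy, Pi.sub_apply]
  congr 1; ring

theorem tendsto_ofReal_rpow_neg (hn : 1 ≤ n) :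
    Tendsto (fun t : ℝ => ENNReal.ofReal (t ^ (-(n : ℝ) / 2))) (𝓝[>] 0) (𝓝 ⊤) := by
  refine ENNReal.tendsto_ofReal_atTop.comp (tendsto_rpow_neg_nhdsGT_zero ?_)
  have : (1 : ℝ) ≤ n := by exact_mod_cast hn
  linarith

end HeatKernel

/-! ### The smoothing bound and its uniform small-time refinement -/

theorem corollaryA (n : ℕ) (hn : 1 ≤ n) (Φ : YoungFunction) :
    (∃ C : ℝ, 0 < C ∧ ∀ (φ : OrliczSpace Φ n) (t : ℝ), 0 < t →
      (∀ x, Integrable (fun y => heatKernel (x - y) t * φ.1 y)) ∧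
      MemLp (heatSemigroup t φ.1) ⊤ volume ∧
      eLpNorm (heatSemigroup t φ.1) ⊤ volume ≤
        ENNReal.ofReal C * Φ.inv (ENNReal.ofReal (t ^ (-(n : ℝ) / 2))) * ENNReal.ofReal ‖φ‖) ∧
    (Φ.IsFinite → ∀ K : Set (OrliczSpace Φ n), IsCompact K → K ⊆ OrliczSpaceZero Φ n →
      ∀ ε : ℝ, 0 < ε → ∀ᶠ t : ℝ in 𝓝[>] 0, ∀ φ ∈ K,
        eLpNorm (heatSemigroup t φ.1) ⊤ volume / Φ.inv (ENNReal.ofReal (t ^ (-(n : ℝ) / 2))) <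
          ENNReal.ofReal ε) := by
  refine ⟨⟨2, two_pos, fun φ t ht => ?_⟩, fun hΦ K hK hK0 ε hε => ?_⟩
  · have hle := eLpNorm_heatSemigroup_le ht φ
    refine ⟨integrable_heatKernel_mul ht φ,
      ⟨(stronglyMeasurable_heatSemigroup φ.1.measurable).aestronglyMeasurable, hle.trans_lt ?_⟩, ?_⟩
    · exact ENNReal.mul_lt_top (ENNReal.mul_lt_top (by simp)
        (Φ.inv_ne_top ENNReal.ofReal_ne_top).lt_top) ENNReal.ofReal_lt_top
    · rwa [ENNReal.ofReal_ofNat]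
  · have hbdd : ∀ g ∈ {u : OrliczSpace Φ n | ∃ g : EuclideanSpace ℝ (Fin n) → ℝ,
        ContDiff ℝ ((⊤ : ℕ∞) : WithTop ℕ∞) g ∧ HasCompactSupport g ∧
          (u : EuclideanSpace ℝ (Fin n) →ₘ[volume] ℝ) =ᵐ[volume] g},
        ∃ B : ℝ≥0, ∀ᵐ y, ‖g.1 y‖ₑ ≤ B := by
      rintro g ⟨f, hf, hfc, hgf⟩
      obtain ⟨C, hC⟩ := hfc.exists_bound_of_continuous hf.continuous
      refine ⟨C.toNNReal, hgf.mono fun y hy => ?_⟩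
      rw [hy, ← ofReal_norm]
      exact ENNReal.ofReal_le_ofReal (hC y)
    have hev : ∀ φ ∈ K, ∃ U ∈ 𝓝[K] φ, ∀ᶠ t : ℝ in 𝓝[>] 0, ∀ ψ ∈ U,
        eLpNorm (heatSemigroup t ψ.1) ⊤ volume / Φ.inv (ENNReal.ofReal (t ^ (-(n : ℝ) / 2))) <
          ENNReal.ofReal ε := by
      intro φ hφ
      -- With the constant 2, radius `ε / 4` costs `ε / 2`; the other `ε / 2` is left for `B / M`.
      obtain ⟨g, hg, hφg⟩ := Metric.mem_closure_iff.1 (hK0 hφ) (ε / 4) (by positivity)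
      obtain ⟨B, hB⟩ := hbdd g hg
      -- The ball is centred at `g`, not `φ`, so the same `g` and `B` work for every `ψ` in it.
      refine ⟨Metric.ball g (ε / 4),
        mem_nhdsWithin_of_mem_nhds (Metric.isOpen_ball.mem_nhds hφg), ?_⟩
      have hinv := hΦ.tendsto_inv.comp (tendsto_ofReal_rpow_neg hn)
      have hdiv : Tendsto (fun t : ℝ =>
          (B : ℝ≥0∞) / Φ.inv (ENNReal.ofReal (t ^ (-(n : ℝ) / 2)))) (𝓝[>] 0) (𝓝 0) := by
        simpa using ENNReal.Tendsto.const_div hinv (Or.inr (ENNReal.coe_ne_top (r := B)))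
      have hpos : (0 : ℝ≥0∞) < ENNReal.ofReal (ε / 2) := ENNReal.ofReal_pos.2 (by positivity)
      filter_upwards [hdiv.eventually_lt_const hpos,
        hinv.eventually_const_lt ENNReal.zero_lt_top, self_mem_nhdsWithin] with t h1 h2 ht ψ hψ
      have hM := Φ.inv_ne_top (y := ENNReal.ofReal (t ^ (-(n : ℝ) / 2))) ENNReal.ofReal_ne_top
      have h3 := eLpNorm_heatSemigroup_le_add ht ψ g hB
      simp only [Function.comp_apply] at h2
      generalize Φ.inv (ENNReal.ofReal (t ^ (-(n : ℝ) / 2))) = M at *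
      have h4 : 2 * ENNReal.ofReal ‖ψ - g‖ ≤ ENNReal.ofReal (ε / 2) := by
        rw [two_mul, ← ENNReal.ofReal_add (norm_nonneg _) (norm_nonneg _)]
        refine ENNReal.ofReal_le_ofReal ?_
        rw [Metric.mem_ball, dist_eq_norm] at hψ
        linarith
      calc _ ≤ (2 * M * ENNReal.ofReal ‖ψ - g‖ + B) / M := by gcongr
        _ = 2 * ENNReal.ofReal ‖ψ - g‖ + B / M := by
          rw [ENNReal.add_div, mul_right_comm, ENNReal.mul_div_cancel_right h2.ne' hM]
        _ < ENNReal.ofReal (ε / 2) + ENNReal.ofReal (ε / 2) :=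
          ENNReal.add_lt_add_of_le_of_lt (ne_top_of_le_ne_top ENNReal.ofReal_ne_top h4) h4 h1
        _ = ENNReal.ofReal ε := by
          rw [← ENNReal.ofReal_add (by positivity) (by positivity), add_halves]
    -- Local uniformity passes to `K` because the property is inherited by subsets and finite
    -- unions.
    refine hK.induction_on (p := fun U => ∀ᶠ t : ℝ in 𝓝[>] 0, ∀ ψ ∈ U,
        eLpNorm (heatSemigroup t ψ.1) ⊤ volume / Φ.inv (ENNReal.ofReal (t ^ (-(n : ℝ) / 2))) <
          ENNReal.ofReal ε) (by simp) (fun S T hST hT => hT.mono fun t ht ψ hψ => ht ψ (hST hψ))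
      (fun S T hS hT => ?_) hev
    filter_upwards [hS, hT] with t h1 h2 ψ hψ
    exact hψ.elim (h1 ψ) (h2 ψ)
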